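/- Let $n\ge 4$ and let $B\subset\mathbb{R}^{n+1}$ be a symmetric convex body, i.e. a compact convex set with nonempty interior and $B=-B$. A hyperplane is a linear subspace of codimension $1$; for a hyperplane $H$, the hyperplane section $H\cap B$ is regarded as a subset of the vector space $H$. A symmetric convex body $K\subset\mathbb{R}^m$ is called a symmetric body of revolution if there is a $1$-dimensional linear subspace $L\subset\mathbb{R}^m$ (an axis of revolution) such that for every affine hyperplane $A$ orthogonal to $L$ the section $A\cap K$ is a closed Euclidean ball in $A$ centered at the point $A\cap L$ (possibly a single point or empty). A subset of a finite-dimensional real vector space is called an affine body of revolution if some linear isomorphism from that vector space to a Euclidean space $\mathbb{R}^m$ maps it onto a symmetric body of revolution, and an ellipsoid if some affine isomorphism from that vector space to a Euclidean space $\mathbb{R}^m$ maps it onto the closed unit ball of $\mathbb{R}^m$. Suppose that for every hyperplane $H\subset\mathbb{R}^{n+1}$ the section $H\cap B$ is an affine body of revolution (the sections for different $H$ are not assumed to be linearly equivalent to one another). Then there is a hyperplane $H\subset\mathbb{R}^{n+1}$ such that $H\cap B$ is an ellipsoid. -/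

import Mathlib

namespace BodiesOfRevolution

/-- A symmetric convex body: compact, convex, with nonempty interior, invariant under `x ↦ -x`. -/
structure IsSymmetricConvexBody {V : Type*} [NormedAddCommGroup V] [NormedSpace ℝ V]
    (K : Set V) : Prop where
  isCompact : IsCompact K
  convex : Convex ℝ K
  nonempty_interior : (interior K).Nonempty
  neg_mem : ∀ x ∈ K, -x ∈ K

/-- A hyperplane: a linear subspace of codimension 1. -/
def IsHyperplane {V : Type*} [AddCommGroup V] [Module ℝ V] (H : Submodule ℝ V) : Prop :=
  Module.finrank ℝ (V ⧸ H) = 1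

/-- The section of `B` by the linear subspace `H`, as a subset of the vector space `H`. -/
def linearSection {V : Type*} [AddCommGroup V] [Module ℝ V] (B : Set V) (H : Submodule ℝ V) :
    Set H :=
  {x : H | (x : V) ∈ B}

/-- Linear equivalence of two sets, each a subset of a real vector space. -/
def LinearlyEquivalent {V W : Type*} [AddCommGroup V] [Module ℝ V] [AddCommGroup W] [Module ℝ W]
    (K : Set V) (K' : Set W) : Prop :=
  ∃ T : V ≃ₗ[ℝ] W, T '' K = K'

/-- Affine equivalence of two sets, each a subset of a real vector space. -/
def AffinelyEquivalent {V W : Type*} [AddCommGroup V] [Module ℝ V] [AddCommGroup W] [Module ℝ W]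
    (K : Set V) (K' : Set W) : Prop :=
  ∃ T : V ≃ᵃ[ℝ] W, T '' K = K'

/-- An ellipsoid: a subset of a vector space affinely equivalent to the closed unit ball of a
Euclidean space. -/
def IsEllipsoid {V : Type*} [AddCommGroup V] [Module ℝ V] (K : Set V) : Prop :=
  ∃ m : ℕ, AffinelyEquivalent K (Metric.closedBall (0 : EuclideanSpace ℝ (Fin m)) 1)

/-- `L` is an axis of revolution of `K`: a 1-dimensional linear subspace such that the section of
`K` by each affine hyperplane `A` orthogonal to `L` is a closed ball in `A` centred at the point
`p` in which `A` meets `L`. The section may be a point (`r = 0`) or empty (`r < 0`). -/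
def IsAxisOfRevolution {m : ℕ} (L : Submodule ℝ (EuclideanSpace ℝ (Fin m)))
    (K : Set (EuclideanSpace ℝ (Fin m))) : Prop :=
  Module.finrank ℝ L = 1 ∧
    ∀ p ∈ L, ∃ r : ℝ,
      K ∩ (AffineSubspace.mk' p Lᗮ : Set (EuclideanSpace ℝ (Fin m))) =
        Metric.closedBall p r ∩ (AffineSubspace.mk' p Lᗮ : Set (EuclideanSpace ℝ (Fin m)))

/-- A symmetric body of revolution in `ℝ^m`. -/
def IsSymmetricBodyOfRevolution {m : ℕ} (K : Set (EuclideanSpace ℝ (Fin m))) : Prop :=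
  IsSymmetricConvexBody K ∧
    ∃ L : Submodule ℝ (EuclideanSpace ℝ (Fin m)), IsAxisOfRevolution L K

/-- An affine (symmetric) body of revolution in a vector space: a set linearly equivalent to a
symmetric body of revolution. -/
def IsAffineBodyOfRevolution {V : Type*} [AddCommGroup V] [Module ℝ V] (K : Set V) : Prop :=
  ∃ (m : ℕ) (K₀ : Set (EuclideanSpace ℝ (Fin m))),
    IsSymmetricBodyOfRevolution K₀ ∧ LinearlyEquivalent K K₀

end BodiesOfRevolution

/-!
Let `N` be the gauge of `B`, so that the claim becomes one about the norm `N`: if its restriction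
to each hyperplane is a norm of revolution, then on some hyperplane it is Euclidean. In the
hyperplane `x^⊥` of a unit vector `x` write `a` for an `N`-unit vector on the axis and `M` for the
equator, the complement of the axis in `x^⊥` on which `N` is Euclidean (`IsRevolutionAxis`).
Suppose that no restriction is Euclidean.

* An axis never lies in an equator, not even of another section. If `a ∈ M₀`, then since the
  ambient dimension is at least five there is a nonzero `w ∈ M ∩ M₀`; the plane of `a` and `w` lies
  in `M₀`, so `N` is Euclidean on it, and rotation about `a` spreads this to `x^⊥`
  (`IsRevolutionAxis.isEuclideanOn_of_mem_equator`).
* The axis of `x^⊥` is unique (`IsRevolutionAxis.unique`). Given two axes, add to their plane a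
  direction common to both equators and orthogonal to that plane. The norm on the resulting
  3-space is described by two functions of two variables, and comparing them near the equators shows
  that it is Euclidean there, for one and the same inner product; the composite of the reflections
  in the two axes is then a rotation, which carries every direction of the plane of the axes into
  the region where `N` is Euclidean (`sq_eq_of_two_axes`).
* By compactness the axis depends continuously on `x`: the conditions that define an axis are closed
  and bound it (`isClosed_setOf_isRevolutionAxis`, `IsRevolutionAxis.norm_le`).

Now fix a section with equator `M₀` and let `W` be the plane orthogonal to `M₀`. The projections
to `W` of the axes never vanish, so they form a continuous family of lines in `W` indexed by the
sphere. For `x` on the unit circle of `W` the projected line is orthogonal to `x`, hence makes a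
full turn as `x` does; but the circle bounds a hemisphere, so the family of lines over it is
null-homotopic. This contradiction (`exists_isEuclideanOn_orthogonal`) uses only that
`z ↦ -z ^ 2` does not extend from the circle to the plane.
-/

namespace BodiesOfRevolution

open scoped InnerProductSpace

/-! ### Planar norms with two axes -/

/-- A function on the circle invariant under the reflections in the lines at angles `0` and `θ`
is constant once it is constant on an arc of length `2 θ`, since the composite of the two
reflections is the rotation by `2 θ`. -/
theorem eq_one_of_two_reflections (h : ℝ → ℝ) (θ : ℝ) (hθ : 0 < θ) (hθ' : θ < Real.pi / 2)
    (heven : ∀ ψ, h (-ψ) = h ψ) (hrefl : ∀ ψ, h (2 * θ - ψ) = h ψ)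
    (harc : ∀ ψ, Real.cos ψ ^ 2 * Real.cos θ ^ 2 ≤ Real.sin ψ ^ 2 * Real.sin θ ^ 2 → h ψ = 1)
    (ψ : ℝ) : h ψ = 1 := by
  have hper : Function.Periodic h (2 * θ) := fun x => by
    rw [← heven x, ← hrefl (-x)]
    congr 1
    ring
  obtain ⟨k, ⟨hk1, hk2⟩, -⟩ :=
    existsUnique_add_zsmul_mem_Ioc (a := 2 * θ) (by linarith) ψ (Real.pi / 2 - θ)
  have hk : h (ψ + k • (2 * θ)) = h ψ := hper.zsmul k ψ
  rw [← hk]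
  generalize ψ + k • (2 * θ) = χ at hk1 hk2
  apply harc
  -- `cos² χ cos² θ - sin² χ sin² θ = cos (χ + θ) cos (χ - θ)`
  have h1 : Real.cos (χ + θ) ≤ 0 :=
    Real.cos_nonpos_of_pi_div_two_le_of_le (by linarith) (by linarith)
  have h2 : 0 ≤ Real.cos (χ - θ) := Real.cos_nonneg_of_mem_Icc ⟨by linarith, by linarith⟩
  have h3 := mul_nonpos_of_nonpos_of_nonneg h1 h2
  rw [Real.cos_add, Real.cos_sub] at h3
  nlinarith

/-- The bound `|s| ≤ G t s` excludes that the composite of the two reflections is a shear. -/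
theorem false_of_shear (G : ℝ → ℝ → ℝ) (c : ℝ) (hc : c ≠ 0) (hge : ∀ t s, |s| ≤ G t s)
    (heven : ∀ t s, G t (-s) = G t s) (hrefl : ∀ y, G 1 (c + y) = G 1 (c - y)) : False := by
  have hper : Function.Periodic (G 1) (2 * c) := fun s => by
    have := hrefl (c + s)
    rw [show c - (c + s) = -s by ring, heven] at this
    rw [← this]
    congr 1
    ring
  obtain ⟨k, hk⟩ := exists_nat_gt (G 1 0 / |2 * c|)
  have h1 : G 1 (k • (2 * c)) = G 1 0 := by simpa using hper.nsmul k 0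
  have h2 := hge 1 (k • (2 * c))
  have hpos : 0 < |2 * c| := by positivity
  rw [h1, nsmul_eq_mul, abs_mul, Nat.abs_cast] at h2
  rw [div_lt_iff₀ hpos] at hk
  linarith

/-- Two functions `G`, `G'` describe a norm on `ℝ³` in coordinates adapted to two axes of
revolution, which span the plane of the first two coordinates. The axes being different, and
neither lying in the equator of the other, the norm is Euclidean. Here the second axis and the
equatorial direction of the second structure are `(α, β)` and `(p, q)` in the coordinates of the
first one. -/
theorem sq_eq_of_two_axes (G G' : ℝ → ℝ → ℝ) (α β p q : ℝ) (hα : α ≠ 0) (hβ : β ≠ 0)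
    (hq : q ≠ 0) (hd : α * q - β * p ≠ 0)
    (hG : ∀ c t s, G (c * t) (c * s) = |c| * G t s)
    (hG0 : ∀ s, G 0 s = |s|) (hG0' : ∀ s, G' 0 s = |s|)
    (heven : ∀ t s, G t (-s) = G t s) (heven' : ∀ t s, G' t (-s) = G' t s)
    (hge : ∀ t s, |s| ≤ G t s)
    (rel : ∀ x y r, G (α * x + p * y) √((β * x + q * y) ^ 2 + r ^ 2) = G' x √(y ^ 2 + r ^ 2)) :
    ∀ t, G t 1 ^ 2 = G 1 0 ^ 2 * t ^ 2 + 1 := by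
  have habs : ∀ t s, G t |s| = G t s := fun t s => by
    rcases abs_choice s with h | h <;> rw [h]
    exact heven t s
  have habs' : ∀ t s, G' t |s| = G' t s := fun t s => by
    rcases abs_choice s with h | h <;> rw [h]
    exact heven' t s
  have rel0 : ∀ x y, G (α * x + p * y) (β * x + q * y) = G' x y := fun x y => by
    have := rel x y 0
    simpa [Real.sqrt_sq_eq_abs, habs, habs'] using this
  have hp : p ≠ 0 := by
    rintro rfl
    refine false_of_shear G (β / α) (div_ne_zero hβ hα) hge heven fun y => ?_
    have h1 := rel0 (1 / α) (y / q)
    have h2 := rel0 (1 / α) (-(y / q))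
    rw [heven', ← h1] at h2
    field_simp at h2
    simp only [zero_mul, add_zero] at h2
    convert h2.symm using 2 <;> field_simp <;> ring
  -- Comparison of the two descriptions on the equators gives quadratic formulas near them.
  have hcone : ∀ t s, q ^ 2 * t ^ 2 ≤ p ^ 2 * s ^ 2 →
      G t s ^ 2 = (1 - q ^ 2) / p ^ 2 * t ^ 2 + s ^ 2 := fun t s hts => by
    have hr : 0 ≤ s ^ 2 - q ^ 2 * (t / p) ^ 2 := by
      rw [div_pow, ← mul_div_assoc, sub_nonneg, div_le_iff₀ (by positivity)]
      linarith
    have h := rel 0 (t / p) √(s ^ 2 - q ^ 2 * (t / p) ^ 2)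
    rw [hG0', Real.sq_sqrt hr, abs_of_nonneg (Real.sqrt_nonneg _)] at h
    have e1 : (β * 0 + q * (t / p)) ^ 2 + (s ^ 2 - q ^ 2 * (t / p) ^ 2) = s ^ 2 := by ring
    have e2 : α * 0 + p * (t / p) = t := by field_simp; ring
    rw [e1, e2, Real.sqrt_sq_eq_abs, habs] at h
    rw [h, Real.sq_sqrt (by nlinarith [sq_nonneg (t / p)])]
    field_simp
    ring
  set d := α * q - β * p with hd_def
  have hcone' : ∀ t s, α ^ 2 * t ^ 2 ≤ p ^ 2 * s ^ 2 →
      G' t s ^ 2 = (d ^ 2 - α ^ 2) / p ^ 2 * t ^ 2 + s ^ 2 := fun t s hts => by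
    have hr : 0 ≤ s ^ 2 - (α * t / p) ^ 2 := by
      rw [div_pow, sub_nonneg, div_le_iff₀ (by positivity)]
      nlinarith
    have h := rel t (-(α * t / p)) √(s ^ 2 - (α * t / p) ^ 2)
    rw [Real.sq_sqrt hr] at h
    have e1 : (-(α * t / p)) ^ 2 + (s ^ 2 - (α * t / p) ^ 2) = s ^ 2 := by ring
    have e2 : α * t + p * -(α * t / p) = 0 := by field_simp; ring
    rw [e1, e2, hG0, abs_of_nonneg (Real.sqrt_nonneg _), Real.sqrt_sq_eq_abs, habs'] at h
    rw [← h, Real.sq_sqrt (by nlinarith [sq_nonneg (β * t + q * -(α * t / p))])]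
    rw [hd_def]
    field_simp
    ring
  set γ := (1 - q ^ 2) / p ^ 2 with hγ
  set γ' := (d ^ 2 - α ^ 2) / p ^ 2 with hγ'
  -- The two quadratic forms agree near the common equatorial direction, hence everywhere.
  have hnorm : γ * α ^ 2 + β ^ 2 = γ' := by
    set ε := |p| / (1 + |α * q| + |α|) with hε
    have hden : 0 < 1 + |α * q| + |α| := by positivity
    have hεpos : 0 < ε := by positivity
    have hεmul : ε * (1 + |α * q| + |α|) = |p| := by rw [hε]; field_simp
    have b1 : (ε * |α * q|) ^ 2 ≤ |p| ^ 2 := by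
      apply pow_le_pow_left₀ (by positivity)
      nlinarith [abs_nonneg α, mul_nonneg hεpos.le (abs_nonneg α)]
    have b2 : (ε * |α|) ^ 2 ≤ |p| ^ 2 := by
      apply pow_le_pow_left₀ (by positivity)
      nlinarith [mul_nonneg hεpos.le (abs_nonneg (α * q))]
    rw [mul_pow, sq_abs, sq_abs] at b1 b2
    have h := rel ε 0 1
    have hs : √((β * ε + q * 0) ^ 2 + 1 ^ 2) ^ 2 = β ^ 2 * ε ^ 2 + 1 := by
      rw [Real.sq_sqrt (by positivity)]; ring
    have h1 := hcone (α * ε + p * 0) √((β * ε + q * 0) ^ 2 + 1 ^ 2) (by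
      rw [hs]; nlinarith [sq_nonneg (p * β * ε)])
    have hs' : √((0 : ℝ) ^ 2 + 1 ^ 2) = 1 := by norm_num
    have h2 := hcone' ε 1 (by linarith)
    rw [h, hs, hs', h2] at h1
    have h3 : (γ * α ^ 2 + β ^ 2 - γ') * ε ^ 2 = 0 := by linarith
    have h4 := (mul_eq_zero.1 h3).resolve_right (by positivity)
    linarith
  have horth : γ * α * p + β * q = 0 := by
    have h1 : (γ * α ^ 2 + β ^ 2) * p ^ 2 = γ' * p ^ 2 := by rw [hnorm]
    have h2 : γ * p ^ 2 = 1 - q ^ 2 := by rw [hγ]; field_simp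
    have h3 : γ' * p ^ 2 = d ^ 2 - α ^ 2 := by rw [hγ']; field_simp
    rw [h3, hd_def] at h1
    have h4 : (γ * α * p + β * q) * (α * p) = 0 := by nlinarith
    exact (mul_eq_zero.1 h4).resolve_right (mul_ne_zero hα hp)
  have hγpos : 0 < γ := by
    have h1 : 0 ≤ γ := by
      have h := hge p q
      have h2 := hcone p q (by linarith)
      have h3 : |q| ^ 2 ≤ G p q ^ 2 := pow_le_pow_left₀ (abs_nonneg _) h 2
      rw [sq_abs, h2] at h3
      have : 0 < p ^ 2 := by positivity
      by_contra hneg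
      nlinarith
    refine lt_of_le_of_ne h1 fun h0 => mul_ne_zero hβ hq ?_
    rw [← h0] at horth
    linarith
  have hγ'pos : 0 < γ' := by rw [← hnorm]; positivity
  have hreflect : ∀ t s, G (2 * ((γ * α * t + β * s) / γ') * α - t)
      (2 * ((γ * α * t + β * s) / γ') * β - s) = G t s := fun t s => by
    obtain ⟨x, y, rfl, rfl⟩ : ∃ x y, t = α * x + p * y ∧ s = β * x + q * y :=
      ⟨(q * t - p * s) / d, (α * s - β * t) / d, by field_simp; ring, by field_simp; ring⟩
    have hx : (γ * α * (α * x + p * y) + β * (β * x + q * y)) / γ' = x := by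
      rw [div_eq_iff hγ'pos.ne', ← hnorm]
      linear_combination y * horth
    rw [hx, rel0, ← heven', ← rel0]
    congr 1 <;> ring
  obtain ⟨g, hgpos, hg⟩ : ∃ g : ℝ, 0 < g ∧ γ = g ^ 2 :=
    ⟨√γ, Real.sqrt_pos.2 hγpos, (Real.sq_sqrt hγpos.le).symm⟩
  set h : ℝ → ℝ := fun ψ => G (Real.cos ψ / g) (Real.sin ψ) ^ 2 with hh
  have hhcone : ∀ ψ, γ * α ^ 2 * Real.cos ψ ^ 2 ≤ β ^ 2 * Real.sin ψ ^ 2 → h ψ = 1 := by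
    intro ψ hψ
    have e1 : q ^ 2 * β ^ 2 = γ ^ 2 * α ^ 2 * p ^ 2 := by
      have : β * q = -(γ * α * p) := by linarith
      rw [← mul_pow, mul_comm q β, this]; ring
    have e2 : q ^ 2 * Real.cos ψ ^ 2 ≤ γ * p ^ 2 * Real.sin ψ ^ 2 := by
      have e3 : (γ * α ^ 2) * (q ^ 2 * Real.cos ψ ^ 2) ≤
          (γ * α ^ 2) * (γ * p ^ 2 * Real.sin ψ ^ 2) := by
        have := mul_le_mul_of_nonneg_left hψ (sq_nonneg q)
        calc _ = q ^ 2 * (γ * α ^ 2 * Real.cos ψ ^ 2) := by ring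
          _ ≤ q ^ 2 * (β ^ 2 * Real.sin ψ ^ 2) := this
          _ = q ^ 2 * β ^ 2 * Real.sin ψ ^ 2 := by ring
          _ = _ := by rw [e1]; ring
      exact le_of_mul_le_mul_left e3 (by positivity)
    have := hcone (Real.cos ψ / g) (Real.sin ψ) (by
      rw [div_pow, ← hg, ← mul_div_assoc, div_le_iff₀ hγpos]; linarith)
    rw [hh]
    simp only
    rw [this, div_pow, ← hg, mul_div_cancel₀ _ hγpos.ne']
    exact Real.cos_sq_add_sin_sq ψ
  have hheven : ∀ ψ, h (-ψ) = h ψ := fun ψ => by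
    simp only [hh, Real.cos_neg, Real.sin_neg, heven]
  set θ := Real.arctan (β / (g * α)) with hθ
  have hcospos : 0 < Real.cos θ := Real.cos_arctan_pos _
  have htan : Real.sin θ * (g * α) = β * Real.cos θ := by
    have h1 : Real.tan θ = β / (g * α) := Real.tan_arctan _
    rw [Real.tan_eq_sin_div_cos] at h1
    field_simp at h1
    linarith
  have hcs := Real.sin_sq_add_cos_sq θ
  have hc2 : γ * α ^ 2 = γ' * Real.cos θ ^ 2 := by
    rw [← hnorm]
    have : Real.sin θ ^ 2 * (γ * α ^ 2) = β ^ 2 * Real.cos θ ^ 2 := by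
      rw [← mul_pow, ← htan, hg]; ring
    linear_combination γ * α ^ 2 * (-hcs) + this
  have hs2 : β ^ 2 = γ' * Real.sin θ ^ 2 := by
    linear_combination hnorm - hc2 + γ' * (-hcs)
  have hsc : g * α * β = γ' * (Real.sin θ * Real.cos θ) := by
    apply mul_right_cancel₀ hcospos.ne'
    linear_combination (-(g * α)) * htan + Real.sin θ * hc2 - α ^ 2 * Real.sin θ * hg
  have hhrefl : ∀ ψ, h (2 * θ - ψ) = h ψ := fun ψ => by
    have := hreflect (Real.cos ψ / g) (Real.sin ψ)
    simp only [hh]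
    rw [← this, Real.cos_sub, Real.sin_sub, Real.cos_two_mul, Real.sin_two_mul]
    have k1 : (γ * α * (Real.cos ψ / g) + β * Real.sin ψ) / γ' * (g * α) =
        Real.cos θ ^ 2 * Real.cos ψ + Real.sin θ * Real.cos θ * Real.sin ψ := by
      rw [div_mul_eq_mul_div, div_eq_iff hγ'pos.ne']
      field_simp
      linear_combination Real.cos ψ * hc2 + Real.sin ψ * hsc
    have k2 : (γ * α * (Real.cos ψ / g) + β * Real.sin ψ) / γ' * β =
        Real.sin θ * Real.cos θ * Real.cos ψ + Real.sin θ ^ 2 * Real.sin ψ := by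
      rw [div_mul_eq_mul_div, div_eq_iff hγ'pos.ne', hg]
      field_simp
      linear_combination Real.cos ψ * hsc + Real.sin ψ * hs2
    congr 2
    · have k3 : Real.cos ψ / g * g = Real.cos ψ := div_mul_cancel₀ _ hgpos.ne'
      rw [div_eq_iff hgpos.ne']
      linear_combination (-2) * k1 + k3
    · linear_combination (-2) * k2 - 2 * Real.sin ψ * hcs
  have hone : ∀ ψ, h ψ = 1 := by
    have hθne : θ ≠ 0 := by
      intro h0
      rw [h0] at hs2
      simp at hs2
      exact hβ hs2
    have harc : ∀ ψ, Real.cos ψ ^ 2 * Real.cos θ ^ 2 ≤ Real.sin ψ ^ 2 * Real.sin θ ^ 2 →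
        h ψ = 1 := fun ψ hψ => hhcone ψ (by
      rw [hc2, hs2]
      nlinarith)
    rcases lt_or_gt_of_ne hθne with h0 | h0
    · refine eq_one_of_two_reflections h (-θ) (by linarith)
        (by linarith [Real.neg_pi_div_two_lt_arctan (β / (g * α))]) hheven (fun ψ => ?_)
        (by simpa using harc)
      rw [← hheven, ← hhrefl, ← hheven ψ]
      rw [show 2 * θ - -(2 * -θ - ψ) = -ψ by ring]
    · exact eq_one_of_two_reflections h θ h0 (Real.arctan_lt_pi_div_two _) hheven hhrefl harc
  intro t
  have hγG : G 1 0 ^ 2 = γ := by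
    have h1 := hone 0
    simp only [hh, Real.cos_zero, Real.sin_zero] at h1
    have h2 := hG g (1 / g) 0
    rw [mul_one_div_cancel hgpos.ne', mul_zero] at h2
    rw [h2, mul_pow, sq_abs, h1, hg, mul_one]
  rw [hγG]
  have hR : 0 < √(1 + (g * t) ^ 2) := by positivity
  have hRsq : √(1 + (g * t) ^ 2) ^ 2 = 1 + (g * t) ^ 2 := Real.sq_sqrt (by positivity)
  have h1 := hone (Real.pi / 2 - Real.arctan (g * t))
  simp only [hh, Real.cos_pi_div_two_sub, Real.sin_pi_div_two_sub, Real.sin_arctan,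
    Real.cos_arctan] at h1
  have h2 := hG √(1 + (g * t) ^ 2) (g * t / √(1 + (g * t) ^ 2) / g) (1 / √(1 + (g * t) ^ 2))
  rw [show √(1 + (g * t) ^ 2) * (g * t / √(1 + (g * t) ^ 2) / g) = t by field_simp,
    mul_one_div_cancel hR.ne'] at h2
  rw [h2, mul_pow, sq_abs, h1, hRsq, hg]
  ring

/-! ### Euclidean subspaces of a normed space -/

section Geometry

variable {E : Type*} [NormedAddCommGroup E] [InnerProductSpace ℝ E]

/-- The seminorm `N` is Euclidean on the subspace `S`, expressed by the parallelogram law. In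
this form the condition is closed, and needs no choice of an inner product. -/
def IsEuclideanOn (N : Seminorm ℝ E) (S : Submodule ℝ E) : Prop :=
  ∀ v ∈ S, ∀ w ∈ S, N (v + w) ^ 2 + N (v - w) ^ 2 = 2 * (N v ^ 2 + N w ^ 2)

/-- The Jordan–von Neumann theorem for a norm on a bare finite-dimensional vector space. -/
theorem exists_linearEquiv_norm_eq {V : Type*} [AddCommGroup V] [Module ℝ V]
    [FiniteDimensional ℝ V] (N : Seminorm ℝ V) (hN : ∀ v, N v = 0 → v = 0)
    (h : ∀ v w, N (v + w) ^ 2 + N (v - w) ^ 2 = 2 * (N v ^ 2 + N w ^ 2)) :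
    ∃ (m : ℕ) (T : V ≃ₗ[ℝ] EuclideanSpace ℝ (Fin m)), ∀ v, ‖T v‖ = N v := by
  let : Norm V := ⟨N⟩
  have core : NormedSpace.Core ℝ V :=
    { norm_nonneg := fun v => apply_nonneg N v
      norm_smul := fun c v => map_smul_eq_mul N c v
      norm_triangle := fun v w => map_add_le_add N v w
      norm_eq_zero_iff := fun v => ⟨hN v, fun hv => by subst hv; exact map_zero N⟩ }
  let := NormedAddCommGroup.ofCore core
  let : NormedSpace ℝ V := NormedSpace.ofCore core
  let := InnerProductSpace.ofNorm ℝ (E := V) fun v w => by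
    have := h v w
    simp only [sq] at this
    exact this
  exact ⟨_, (stdOrthonormalBasis ℝ V).repr.toLinearEquiv,
    fun v => (stdOrthonormalBasis ℝ V).repr.norm_map v⟩

/-- Orthogonality to a vector `e`, with respect to a norm that is Euclidean on `S`, is given by
a linear functional. -/
theorem IsEuclideanOn.exists_polar [FiniteDimensional ℝ E] {N : Seminorm ℝ E}
    (hN : ∀ v, N v = 0 → v = 0) {S : Submodule ℝ E} (hS : IsEuclideanOn N S) {e : E}
    (he : e ∈ S) :
    ∃ f : E →ₗ[ℝ] ℝ, ∀ v ∈ S, N (e + v) ^ 2 - N (e - v) ^ 2 = 4 * f v := by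
  obtain ⟨m, T, hT⟩ := exists_linearEquiv_norm_eq (N.comp S.subtype)
    (fun v hv => Subtype.ext (hN v hv)) (fun v w => hS v v.2 w w.2)
  obtain ⟨f, hf⟩ := LinearMap.exists_extend ((innerₗ _ (T ⟨e, he⟩)).comp T.toLinearMap)
  refine ⟨f, fun v hv => ?_⟩
  have h1 : f v = ⟪T ⟨e, he⟩, T ⟨v, hv⟩⟫_ℝ := by
    have := LinearMap.congr_fun hf ⟨v, hv⟩
    simpa using this
  have h2 : N (e + v) = ‖T ⟨e, he⟩ + T ⟨v, hv⟩‖ := by rw [← map_add, hT]; rfl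
  have h3 : N (e - v) = ‖T ⟨e, he⟩ - T ⟨v, hv⟩‖ := by rw [← map_sub, hT]; rfl
  rw [h1, h2, h3, norm_add_sq_real, norm_sub_sq_real]
  ring

theorem exists_ne_zero_of_four [FiniteDimensional ℝ E] (hE : 5 ≤ Module.finrank ℝ E)
    (f₁ f₂ f₃ f₄ : E →ₗ[ℝ] ℝ) : ∃ w, w ≠ 0 ∧ f₁ w = 0 ∧ f₂ w = 0 ∧ f₃ w = 0 ∧ f₄ w = 0 := by
  have h := LinearMap.ker_ne_bot_of_finrank_lt (f := LinearMap.pi ![f₁, f₂, f₃, f₄])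
    (by simp; omega)
  obtain ⟨w, hw, hw0⟩ := Submodule.exists_mem_ne_zero_of_ne_bot h
  rw [LinearMap.mem_ker] at hw
  exact ⟨w, hw0, congr_fun hw 0, congr_fun hw 1, congr_fun hw 2, congr_fun hw 3⟩

/-! ### Axes of revolution of hyperplane sections -/

/-- The subspace of codimension two orthogonal to two vectors. -/
noncomputable def equator (x b : E) : Submodule ℝ E := (Submodule.span ℝ {x, b})ᗮ

theorem mem_equator {x b v : E} : v ∈ equator x b ↔ ⟪x, v⟫_ℝ = 0 ∧ ⟪b, v⟫_ℝ = 0 := by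
  rw [equator, Submodule.mem_orthogonal]
  refine ⟨fun h => ⟨h x (Submodule.subset_span (by simp)), h b (Submodule.subset_span (by simp))⟩,
    fun h u hu => ?_⟩
  obtain ⟨s, t, rfl⟩ := Submodule.mem_span_pair.1 hu
  rw [inner_add_left, inner_smul_left, inner_smul_left, h.1, h.2]
  simp

/-- The restriction of `N` to the hyperplane `x^⊥` is a norm of revolution: its axis is spanned by
the `N`-unit vector `a`, and it is Euclidean on the complement `equator x b` of the axis in
`x^⊥`, where `b` represents the functional `x^⊥ → ℝ` that gives the coordinate along the axis.
The invariance under rotations is stated for vectors `N w • v` and `N v • w` of the same norm in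
the equator, so that no pair of vectors is subject to a side condition and the conditions pass to
limits of `(x, a, b)`. -/
structure IsRevolutionAxis (N : Seminorm ℝ E) (x a b : E) : Prop where
  inner_x_a : ⟪x, a⟫_ℝ = 0
  inner_x_b : ⟪x, b⟫_ℝ = 0
  inner_b_a : ⟪b, a⟫_ℝ = 1
  apply_a : N a = 1
  euclidean : IsEuclideanOn N (equator x b)
  rotation : ∀ v ∈ equator x b, ∀ w ∈ equator x b, ∀ t : ℝ,
    N (t • a + N w • v) = N (t • a + N v • w)

variable {N : Seminorm ℝ E} {x a b : E}

theorem IsRevolutionAxis.sub_mem_equator (h : IsRevolutionAxis N x a b) {v : E}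
    (hv : ⟪x, v⟫_ℝ = 0) : v - ⟪b, v⟫_ℝ • a ∈ equator x b := by
  rw [mem_equator, inner_sub_right, inner_sub_right, inner_smul_right, inner_smul_right, hv,
    h.inner_x_a, h.inner_b_a]
  simp

theorem IsRevolutionAxis.apply_add_eq (h : IsRevolutionAxis N x a b)
    (hN : ∀ v, N v = 0 → v = 0) {v w : E} (hv : v ∈ equator x b) (hw : w ∈ equator x b)
    (hvw : N v = N w) (t : ℝ) : N (t • a + v) = N (t • a + w) := by
  by_cases h0 : N v = 0
  · rw [hN v h0, hN w (hvw ▸ h0)]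
  · have := h.rotation v hv w hw (N v * t)
    rw [← hvw, mul_smul, ← smul_add, ← smul_add, map_smul_eq_mul, map_smul_eq_mul] at this
    exact mul_left_cancel₀ (by simpa using h0) this

theorem IsRevolutionAxis.apply_le (h : IsRevolutionAxis N x a b)
    (hN : ∀ v, N v = 0 → v = 0) {v : E} (hv : v ∈ equator x b) (t : ℝ) :
    N v ≤ N (t • a + v) := by
  have h1 := h.apply_add_eq hN hv (neg_mem hv) (map_neg_eq_map N v).symm t
  have h2 : N (t • a + v + -(t • a + -v)) ≤ N (t • a + v) + N (-(t • a + -v)) :=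
    map_add_le_add _ _ _
  rw [map_neg_eq_map, ← h1, show t • a + v + -(t • a + -v) = (2 : ℝ) • v by rw [two_smul]; abel,
    map_smul_eq_mul, Real.norm_eq_abs, abs_two] at h2
  linarith

theorem IsRevolutionAxis.abs_inner_le (h : IsRevolutionAxis N x a b)
    (hN : ∀ v, N v = 0 → v = 0) {v : E} (hv : ⟪x, v⟫_ℝ = 0) : |⟪b, v⟫_ℝ| ≤ N v := by
  set t := ⟪b, v⟫_ℝ with ht
  have hw := h.sub_mem_equator hv
  rw [← ht] at hw
  have h1 := h.apply_add_eq hN hw (neg_mem hw) (map_neg_eq_map N _).symm t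
  have h2 := map_add_le_add N (t • a + (v - t • a)) (t • a + -(v - t • a))
  rw [← h1, show t • a + (v - t • a) + (t • a + -(v - t • a)) = (2 * t) • a by
    rw [mul_smul, two_smul]; abel, map_smul_eq_mul, h.apply_a, add_sub_cancel, Real.norm_eq_abs,
    abs_mul, abs_two] at h2
  linarith

/-- A norm of revolution is Euclidean if it is so on one plane through the axis. -/
theorem IsRevolutionAxis.isEuclideanOn (h : IsRevolutionAxis N x a b)
    (hN : ∀ v, N v = 0 → v = 0) {w : E} (hw : w ∈ equator x b) (hw1 : N w = 1)
    (hsq : ∀ t : ℝ, N (t • a + w) ^ 2 = t ^ 2 + 1) : IsEuclideanOn N (ℝ ∙ x)ᗮ := by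
  have key : ∀ t : ℝ, ∀ v ∈ equator x b, N (t • a + v) ^ 2 = t ^ 2 + N v ^ 2 := fun t v hv => by
    by_cases h0 : N v = 0
    · rw [hN v h0, add_zero, map_smul_eq_mul, h.apply_a, map_zero]
      simp
    · have hpos : 0 < N v := lt_of_le_of_ne (apply_nonneg N v) (Ne.symm h0)
      rw [h.apply_add_eq hN hv (Submodule.smul_mem _ (N v) hw)
        (by rw [map_smul_eq_mul, hw1, Real.norm_of_nonneg hpos.le, mul_one])]
      have : t • a + N v • w = N v • ((t / N v) • a + w) := by
        rw [smul_add, smul_smul, mul_div_cancel₀ _ h0]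
      rw [this, map_smul_eq_mul, mul_pow, hsq, Real.norm_of_nonneg hpos.le]
      field_simp
  intro v hv v' hv'
  rw [Submodule.mem_orthogonal_singleton_iff_inner_right] at hv hv'
  have hu := h.sub_mem_equator hv
  have hu' := h.sub_mem_equator hv'
  generalize ⟪b, v⟫_ℝ = t at hu
  generalize ⟪b, v'⟫_ℝ = t' at hu'
  obtain ⟨u, rfl⟩ : ∃ u, v = t • a + u := ⟨v - t • a, by abel⟩
  obtain ⟨u', rfl⟩ : ∃ u', v' = t' • a + u' := ⟨v' - t' • a, by abel⟩
  rw [add_sub_cancel_left] at hu hu'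
  rw [show t • a + u + (t' • a + u') = (t + t') • a + (u + u') by rw [add_smul]; abel,
    show t • a + u - (t' • a + u') = (t - t') • a + (u - u') by rw [sub_smul]; abel,
    key _ _ (add_mem hu hu'), key _ _ (sub_mem hu hu'), key _ _ hu, key _ _ hu']
  linear_combination h.euclidean u hu u' hu'

/-- If the axis of one section lies in the equator of another, the first section is an ellipsoid:
the two equators share a vector `w`, and on the plane through the axis and `w` the norm is
Euclidean, because this plane lies in the second equator. -/
theorem IsRevolutionAxis.isEuclideanOn_of_mem_equator [FiniteDimensional ℝ E]
    (hE : 5 ≤ Module.finrank ℝ E) (hN : ∀ v, N v = 0 → v = 0) (h : IsRevolutionAxis N x a b)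
    {x₀ b₀ : E} (h₀ : IsEuclideanOn N (equator x₀ b₀)) (ha : a ∈ equator x₀ b₀) :
    IsEuclideanOn N (ℝ ∙ x)ᗮ := by
  obtain ⟨w, hw0, h1, h2, h3, h4⟩ :=
    exists_ne_zero_of_four hE (innerₗ E x) (innerₗ E b) (innerₗ E x₀) (innerₗ E b₀)
  simp only [innerₗ_apply_apply] at h1 h2 h3 h4
  have hNw : N w ≠ 0 := fun h => hw0 (hN w h)
  set u := (N w)⁻¹ • w with hu_def
  have hu : u ∈ equator x b := Submodule.smul_mem _ _ (mem_equator.2 ⟨h1, h2⟩)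
  have hu₀ : u ∈ equator x₀ b₀ := Submodule.smul_mem _ _ (mem_equator.2 ⟨h3, h4⟩)
  have hu1 : N u = 1 := by
    rw [map_smul_eq_mul, norm_inv, Real.norm_of_nonneg (apply_nonneg N w), inv_mul_cancel₀ hNw]
  refine h.isEuclideanOn hN hu hu1 fun t => ?_
  have hpar := h₀ (t • a) (Submodule.smul_mem _ _ ha) u hu₀
  have hflip := h.apply_add_eq hN hu (neg_mem hu) (map_neg_eq_map N u).symm t
  rw [← sub_eq_add_neg] at hflip
  rw [← hflip, map_smul_eq_mul, h.apply_a, hu1, mul_one, Real.norm_eq_abs, sq_abs] at hpar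
  linarith

/-- The axis of revolution of a hyperplane section is unique unless the section is an
ellipsoid. -/
theorem IsRevolutionAxis.unique [FiniteDimensional ℝ E]
    (hE : 5 ≤ Module.finrank ℝ E) (hN : ∀ v, N v = 0 → v = 0) {a' b' : E}
    (h : IsRevolutionAxis N x a b) (h' : IsRevolutionAxis N x a' b')
    (hx : ¬ IsEuclideanOn N (ℝ ∙ x)ᗮ) : ∃ c : ℝ, a' = c • a := by
  by_contra! hne
  set α := ⟪b, a'⟫_ℝ with hα
  set α' := ⟪b', a⟫_ℝ with hα'
  have hα0 : α ≠ 0 := fun h0 => hx <|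
    h'.isEuclideanOn_of_mem_equator hE hN h.euclidean (mem_equator.2 ⟨h'.inner_x_a, h0⟩)
  have hα0' : α' ≠ 0 := fun h0 => hx <|
    h.isEuclideanOn_of_mem_equator hE hN h'.euclidean (mem_equator.2 ⟨h.inner_x_a, h0⟩)
  -- `e` spans the intersection of the first equator with the plane of the two axes
  have hm := h.sub_mem_equator h'.inner_x_a
  rw [← hα] at hm
  have hβ : N (a' - α • a) ≠ 0 := fun h0 => hne α (sub_eq_zero.1 (hN _ h0))
  set β := N (a' - α • a) with hβ_def
  have hβpos : 0 < β := lt_of_le_of_ne (apply_nonneg N _) (Ne.symm hβ)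
  set e := β⁻¹ • (a' - α • a) with he_def
  have he : e ∈ equator x b := Submodule.smul_mem _ _ hm
  have he1 : N e = 1 := by
    rw [map_smul_eq_mul, norm_inv, Real.norm_of_nonneg hβpos.le, inv_mul_cancel₀ hβ]
  have ha' : a' = α • a + β • e := by
    rw [he_def, smul_smul, mul_inv_cancel₀ hβ, one_smul, add_sub_cancel]
  clear_value e
  set δ := ⟪b', e⟫_ℝ with hδ
  have hdet : α * α' + β * δ = 1 := by
    rw [← h'.inner_b_a, ha', inner_add_right, inner_smul_right, inner_smul_right]
  -- `e'` spans the intersection of the second equator with the same plane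
  have he₁ : α' • e - δ • a ∈ equator x b' := by
    rw [mem_equator, inner_sub_right, inner_sub_right, inner_smul_right, inner_smul_right,
      inner_smul_right, inner_smul_right, (mem_equator.1 he).1, h.inner_x_a]
    refine ⟨by simp, ?_⟩
    rw [← hδ, ← hα']
    ring
  have hν : N (α' • e - δ • a) ≠ 0 := fun h0 => by
    have h1 : α' • e = δ • a := sub_eq_zero.1 (hN _ h0)
    apply hne (α + β * (δ / α'))
    have h2 : e = (δ / α') • a := by
      rw [div_eq_inv_mul, mul_smul, ← h1, smul_smul, inv_mul_cancel₀ hα0', one_smul]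
    rw [ha', h2, smul_smul, add_smul]
  set ν := N (α' • e - δ • a) with hν_def
  have hνpos : 0 < ν := lt_of_le_of_ne (apply_nonneg N _) (Ne.symm hν)
  set e' := ν⁻¹ • (α' • e - δ • a) with he'_def
  have he' : e' ∈ equator x b' := Submodule.smul_mem _ _ he₁
  have he'1 : N e' = 1 := by
    rw [map_smul_eq_mul, norm_inv, Real.norm_of_nonneg hνpos.le, inv_mul_cancel₀ hν]
  have he'_eq : e' = (-δ / ν) • a + (α' / ν) • e := by
    rw [he'_def, smul_sub, smul_smul, smul_smul, neg_div, neg_smul, div_eq_inv_mul,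
      div_eq_inv_mul]
    abel
  clear_value e'
  -- `w` is common to the two equators and orthogonal to `e`
  obtain ⟨f, hf⟩ := h.euclidean.exists_polar hN he
  obtain ⟨w₀, hw0, k1, k2, k3, k4⟩ :=
    exists_ne_zero_of_four hE (innerₗ E x) (innerₗ E b) (innerₗ E b') f
  simp only [innerₗ_apply_apply] at k1 k2 k3
  have hNw : N w₀ ≠ 0 := fun h => hw0 (hN w₀ h)
  set w := (N w₀)⁻¹ • w₀ with hw_def
  have hw : w ∈ equator x b := Submodule.smul_mem _ _ (mem_equator.2 ⟨k1, k2⟩)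
  have hw' : w ∈ equator x b' := Submodule.smul_mem _ _ (mem_equator.2 ⟨k1, k3⟩)
  have hw1 : N w = 1 := by
    rw [map_smul_eq_mul, norm_inv, Real.norm_of_nonneg (apply_nonneg N w₀), inv_mul_cancel₀ hNw]
  have hfw : f w = 0 := by rw [map_smul, k4, smul_zero]
  clear_value w
  have hplane : ∀ s r : ℝ, N (s • e + r • w) ^ 2 = s ^ 2 + r ^ 2 := by
    have h1 : ∀ r : ℝ, N (e + r • w) ^ 2 = 1 + r ^ 2 := fun r => by
      have h2 := hf (r • w) (Submodule.smul_mem _ _ hw)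
      have h3 := h.euclidean e he (r • w) (Submodule.smul_mem _ _ hw)
      rw [map_smul, hfw, smul_zero, mul_zero] at h2
      rw [he1, map_smul_eq_mul, hw1, mul_one, Real.norm_eq_abs, sq_abs] at h3
      linarith
    intro s r
    by_cases hs : s = 0
    · rw [hs, zero_smul, zero_add, map_smul_eq_mul, hw1, mul_one, Real.norm_eq_abs, sq_abs]
      ring
    · have : s • e + r • w = s • (e + (r / s) • w) := by
        rw [smul_add, smul_smul, mul_div_cancel₀ _ hs]
      rw [this, map_smul_eq_mul, mul_pow, h1, Real.norm_eq_abs, sq_abs]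
      field_simp
  have hrot : ∀ t s r : ℝ, N (t • a + (s • e + r • w)) = N (t • a + √(s ^ 2 + r ^ 2) • w) :=
    fun t s r => by
      refine h.apply_add_eq hN (add_mem (Submodule.smul_mem _ _ he) (Submodule.smul_mem _ _ hw))
        (Submodule.smul_mem _ _ hw) ?_ t
      rw [← hplane, Real.sqrt_sq (apply_nonneg _ _), map_smul_eq_mul, hw1, mul_one,
        Real.norm_of_nonneg (apply_nonneg _ _)]
  have hplane' : ∀ s r : ℝ, N (s • e' + r • w) ^ 2 = s ^ 2 + r ^ 2 := fun s r => by
    have h1 : N (s • e' - r • w) = N (s • e' + r • w) := by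
      have h2 : ∀ r : ℝ, s • e' + r • w =
          (s * (-δ / ν)) • a + ((s * (α' / ν)) • e + r • w) := fun r => by
        rw [he'_eq, smul_add, smul_smul, smul_smul, add_assoc]
      rw [sub_eq_add_neg, ← neg_smul, h2, h2, hrot, hrot, neg_sq]
    have h3 := h'.euclidean (s • e') (Submodule.smul_mem _ _ he') (r • w)
      (Submodule.smul_mem _ _ hw')
    rw [h1, map_smul_eq_mul, map_smul_eq_mul, he'1, hw1, mul_one, mul_one, Real.norm_eq_abs,
      Real.norm_eq_abs, sq_abs, sq_abs] at h3
    linarith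
  have hrot' : ∀ t s r : ℝ, N (t • a' + (s • e' + r • w)) = N (t • a' + √(s ^ 2 + r ^ 2) • w) :=
    fun t s r => by
      refine h'.apply_add_eq hN (add_mem (Submodule.smul_mem _ _ he')
        (Submodule.smul_mem _ _ hw')) (Submodule.smul_mem _ _ hw') ?_ t
      rw [← hplane', Real.sqrt_sq (apply_nonneg _ _), map_smul_eq_mul, hw1, mul_one,
        Real.norm_of_nonneg (apply_nonneg _ _)]
  have hsq := sq_eq_of_two_axes (fun t s => N (t • a + s • w)) (fun t s => N (t • a' + s • w))
    α β (-δ / ν) (α' / ν) hα0 hβ (div_ne_zero hα0' hν)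
    (by
      have : α * (α' / ν) - β * (-δ / ν) = 1 / ν := by rw [← hdet]; ring
      rw [this]
      exact one_div_ne_zero hν)
    (fun c t s => by
      simp only [mul_smul, ← smul_add, map_smul_eq_mul, Real.norm_eq_abs])
    (fun s => by simp [map_smul_eq_mul, hw1])
    (fun s => by simp [map_smul_eq_mul, hw1])
    (fun t s => h.apply_add_eq hN (Submodule.smul_mem _ _ hw) (Submodule.smul_mem _ _ hw)
      (by rw [neg_smul, map_neg_eq_map]) t)
    (fun t s => h'.apply_add_eq hN (Submodule.smul_mem _ _ hw') (Submodule.smul_mem _ _ hw')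
      (by rw [neg_smul, map_neg_eq_map]) t)
    (fun t s => by
      have := h.apply_le hN (Submodule.smul_mem _ s hw) t
      rwa [map_smul_eq_mul, hw1, mul_one, Real.norm_eq_abs] at this)
    (fun s y r => by
      rw [← hrot, ← hrot', ha', he'_eq]
      congr 1
      module)
  refine hx (h.isEuclideanOn hN hw hw1 fun t => ?_)
  have := hsq t
  simpa [h.apply_a] using this

end Geometry

/-! ### The winding number obstruction -/

/-- The map `z ↦ -z ^ 2` from the unit circle to itself has winding number two, so that it does
not extend continuously to the plane. -/
theorem false_of_extends_neg_sq (F : ℂ → Circle) (hF : Continuous F)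
    (hbd : ∀ z : Circle, (F z : ℂ) = -(z : ℂ) ^ 2) : False := by
  have hcov := Circle.isCoveringMap_exp
  obtain ⟨s, hs⟩ : ∃ s : ℝ, Circle.exp s = F 0 :=
    ⟨Complex.arg (F 0), Circle.exp_arg _⟩
  obtain ⟨f, ⟨-, hf⟩, -⟩ := hcov.existsUnique_continuousMap_lifts ⟨F, hF⟩ (0 : ℂ) s hs
  have hf' : ∀ z, Circle.exp (f z) = F z := fun z => congr_fun hf z
  have h1 : ((F 1 : Circle) : ℂ) = -1 := by simpa using hbd 1
  have key : (fun t : ℝ => f (Circle.exp t : ℂ)) = fun t : ℝ => 2 * t + f 1 := by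
    refine hcov.eq_of_comp_eq (f.continuous.comp (by fun_prop)) (by fun_prop) ?_ 0 (by simp)
    funext t
    apply Circle.ext
    simp only [Function.comp_apply]
    rw [hf', hbd, Circle.exp_add, hf', Circle.coe_mul, h1, two_mul, Circle.exp_add,
      Circle.coe_mul]
    ring
  have := congr_fun key (2 * Real.pi)
  simp only [Circle.exp_two_pi, Circle.coe_one] at this
  linarith [Real.pi_pos]

theorem exists_circle_mul_norm_sq (w : ℂ) :
    ∃ ζ : Circle, (ζ : ℂ) * (‖w‖ : ℂ) ^ 2 = w ^ 2 := by
  refine ⟨Circle.exp w.arg ^ 2, ?_⟩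
  rw [Circle.coe_pow, ← mul_pow, mul_comm, Circle.coe_exp, Complex.norm_mul_exp_arg_mul_I]

/-- A map to a compact space is continuous if its graph is the projection, along a further
compact space, of a closed set. -/
theorem continuous_of_isClosed_graph_projection {X Y K : Type*} [TopologicalSpace X]
    [TopologicalSpace Y] [TopologicalSpace K] [CompactSpace Y] [CompactSpace K] (f : X → Y)
    (S : Set (X × Y × K)) (hS : IsClosed S) (hf : ∀ x y, y = f x ↔ ∃ k, (x, y, k) ∈ S) :
    Continuous f := by
  refine continuous_iff_isClosed.2 fun C hC => ?_
  have h : f ⁻¹' C = Prod.fst '' (S ∩ {p | p.2.1 ∈ C}) := by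
    ext x
    constructor
    · intro hx
      obtain ⟨k, hk⟩ := (hf x (f x)).1 rfl
      exact ⟨(x, f x, k), ⟨hk, hx⟩, rfl⟩
    · rintro ⟨⟨x, y, k⟩, ⟨hk, hy⟩, rfl⟩
      have : y = f x := (hf x y).2 ⟨k, hk⟩
      exact this ▸ hy
  rw [h]
  exact isClosedMap_fst_of_compactSpace _ (hS.inter (hC.preimage (by fun_prop)))

section Topology

variable {E : Type*} [NormedAddCommGroup E] [InnerProductSpace ℝ E] {N : Seminorm ℝ E}

theorem sub_sub_mem_equator {x a b : E} (hx : ‖x‖ = 1) (hxa : ⟪x, a⟫_ℝ = 0) (hxb : ⟪x, b⟫_ℝ = 0)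
    (hba : ⟪b, a⟫_ℝ = 1) (v : E) : v - ⟪x, v⟫_ℝ • x - ⟪b, v⟫_ℝ • a ∈ equator x b := by
  have hbx : ⟪b, x⟫_ℝ = 0 := by rw [real_inner_comm, hxb]
  simp only [mem_equator, inner_sub_right, inner_smul_right, hxa, hbx, hba,
    real_inner_self_eq_norm_sq, hx]
  constructor <;> ring

/-- The axes of revolution of the hyperplane sections form a closed set. -/
theorem isClosed_setOf_isRevolutionAxis (hcont : Continuous N) :
    IsClosed {p : E × E × E | ‖p.1‖ = 1 ∧ IsRevolutionAxis N p.1 p.2.1 p.2.2} := by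
  -- vectors of the equator are written as projections of arbitrary vectors
  let π : E × E × E → E → E := fun p v => v - ⟪p.1, v⟫_ℝ • p.1 - ⟪p.2.2, v⟫_ℝ • p.2.1
  have hπ : ∀ v, Continuous fun p => π p v := fun v => by
    simp only [π]
    fun_prop
  have h : {p : E × E × E | ‖p.1‖ = 1 ∧ IsRevolutionAxis N p.1 p.2.1 p.2.2} =
      {p | ‖p.1‖ = 1 ∧ ⟪p.1, p.2.1⟫_ℝ = 0 ∧ ⟪p.1, p.2.2⟫_ℝ = 0 ∧ ⟪p.2.2, p.2.1⟫_ℝ = 1 ∧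
        N p.2.1 = 1 ∧
        (∀ v w, N (π p v + π p w) ^ 2 + N (π p v - π p w) ^ 2 =
          2 * (N (π p v) ^ 2 + N (π p w) ^ 2)) ∧
        ∀ v w, ∀ t : ℝ, N (t • p.2.1 + N (π p w) • π p v) =
          N (t • p.2.1 + N (π p v) • π p w)} := by
    ext ⟨x, a, b⟩
    simp only [Set.mem_ofPred_eq]
    constructor
    · rintro ⟨hx, h⟩
      have hmem := sub_sub_mem_equator hx h.inner_x_a h.inner_x_b h.inner_b_a
      exact ⟨hx, h.inner_x_a, h.inner_x_b, h.inner_b_a, h.apply_a,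
        fun v w => h.euclidean _ (hmem v) _ (hmem w),
        fun v w t => h.rotation _ (hmem v) _ (hmem w) t⟩
    · rintro ⟨hx, h1, h2, h3, h4, h5, h6⟩
      have hid : ∀ v ∈ equator x b, π (x, a, b) v = v := fun v hv => by
        simp [π, (mem_equator.1 hv).1, (mem_equator.1 hv).2]
      refine ⟨hx, h1, h2, h3, h4, fun v hv w hw => ?_, fun v hv w hw t => ?_⟩
      · simpa only [hid v hv, hid w hw] using h5 v w
      · simpa only [hid v hv, hid w hw] using h6 v w t
  rw [h]
  simp only [Set.ofPred_and, Set.ofPred_forall]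
  have hπN : ∀ v, Continuous fun p => N (π p v) := fun v => hcont.comp (hπ v)
  refine IsClosed.inter (isClosed_eq (by fun_prop) (by fun_prop)) <|
    IsClosed.inter (isClosed_eq (by fun_prop) (by fun_prop)) <|
    IsClosed.inter (isClosed_eq (by fun_prop) (by fun_prop)) <|
    IsClosed.inter (isClosed_eq (by fun_prop) (by fun_prop)) <|
    IsClosed.inter (isClosed_eq (by fun_prop) (by fun_prop)) <|
    IsClosed.inter ?_ ?_
  · refine isClosed_iInter fun v => isClosed_iInter fun w => isClosed_eq ?_ ?_
    · exact ((hcont.comp ((hπ v).add (hπ w))).pow 2).add ((hcont.comp ((hπ v).sub (hπ w))).pow 2)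
    · exact continuous_const.mul (((hπN v).pow 2).add ((hπN w).pow 2))
  · refine isClosed_iInter fun v => isClosed_iInter fun w => isClosed_iInter fun t =>
      isClosed_eq ?_ ?_
    · exact hcont.comp ((by fun_prop : Continuous fun p : E × E × E => t • p.2.1).add
        ((hπN w).smul (hπ v)))
    · exact hcont.comp ((by fun_prop : Continuous fun p : E × E × E => t • p.2.1).add
        ((hπN v).smul (hπ w)))

theorem IsRevolutionAxis.norm_le {x a b : E} {c C : ℝ} (hc : 0 < c) (hlow : ∀ v, c * ‖v‖ ≤ N v)
    (hup : ∀ v, N v ≤ C * ‖v‖) (h : IsRevolutionAxis N x a b) :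
    ‖a‖ ≤ 1 / c ∧ ‖b‖ ≤ C := by
  have hN : ∀ v, N v = 0 → v = 0 := fun v hv => by
    have := hlow v
    rw [hv] at this
    exact norm_le_zero_iff.1 (nonpos_of_mul_nonpos_right this hc)
  constructor
  · rw [le_div_iff₀ hc, mul_comm, ← h.apply_a]
    exact hlow a
  · have h1 := (h.abs_inner_le hN h.inner_x_b).trans (hup b)
    rw [real_inner_self_eq_norm_sq, abs_of_nonneg (sq_nonneg _), sq] at h1
    have hb : 0 < ‖b‖ := norm_pos_iff.2 fun hb => by
      have := h.inner_b_a
      rw [hb, inner_zero_left] at this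
      exact zero_ne_one this
    exact le_of_mul_le_mul_right h1 hb

/-- If all hyperplane sections have axes of revolution then one of them is Euclidean. Otherwise
the axis of `x^⊥`, projected to the plane orthogonal to the equator of a fixed section, never
vanishes. On the circle of the unit vectors `x` in this plane the projected line is orthogonal to
`x`, so it turns around once; but it extends continuously to a hemisphere bounded by the circle. -/
theorem exists_isEuclideanOn_orthogonal [FiniteDimensional ℝ E]
    (hE : 5 ≤ Module.finrank ℝ E) {c C : ℝ} (hc : 0 < c) (hlow : ∀ v, c * ‖v‖ ≤ N v)
    (hup : ∀ v, N v ≤ C * ‖v‖) (hcont : Continuous N)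
    (hrev : ∀ x : E, ‖x‖ = 1 → ∃ a b, IsRevolutionAxis N x a b) :
    ∃ x : E, ‖x‖ = 1 ∧ IsEuclideanOn N (ℝ ∙ x)ᗮ := by
  by_contra! hno
  have hN : ∀ v, N v = 0 → v = 0 := fun v hv => by
    have := hlow v
    rw [hv] at this
    exact norm_le_zero_iff.1 (nonpos_of_mul_nonpos_right this hc)
  -- an orthonormal triple `e₁, e₂, e₃`, with `e₁, e₂` orthogonal to the equator of `e₁^⊥`
  obtain ⟨x₀, hx₀, -⟩ := exists_ne_zero_of_four hE 0 0 0 0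
  set e₁ := ‖x₀‖⁻¹ • x₀ with he₁_def
  have he₁ : ‖e₁‖ = 1 := by
    rw [he₁_def, norm_smul, norm_inv, norm_norm, inv_mul_cancel₀ (norm_ne_zero_iff.2 hx₀)]
  clear_value e₁
  obtain ⟨a₀, b₀, h₀⟩ := hrev e₁ he₁
  have hb₀ : b₀ ≠ 0 := fun hb => by
    have := h₀.inner_b_a
    rw [hb, inner_zero_left] at this
    exact zero_ne_one this
  set e₂ := ‖b₀‖⁻¹ • b₀ with he₂_def
  have he₂ : ‖e₂‖ = 1 := by
    rw [he₂_def, norm_smul, norm_inv, norm_norm, inv_mul_cancel₀ (norm_ne_zero_iff.2 hb₀)]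
  have he₁₂ : ⟪e₁, e₂⟫_ℝ = 0 := by rw [he₂_def, inner_smul_right, h₀.inner_x_b, mul_zero]
  clear_value e₂
  obtain ⟨x₃, hx₃, h₁₃, h₂₃, -⟩ := exists_ne_zero_of_four hE (innerₗ E e₁) (innerₗ E e₂) 0 0
  rw [innerₗ_apply_apply] at h₁₃ h₂₃
  set e₃ := ‖x₃‖⁻¹ • x₃ with he₃_def
  have he₃ : ‖e₃‖ = 1 := by
    rw [he₃_def, norm_smul, norm_inv, norm_norm, inv_mul_cancel₀ (norm_ne_zero_iff.2 hx₃)]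
  have he₁₃ : ⟪e₁, e₃⟫_ℝ = 0 := by rw [he₃_def, inner_smul_right, h₁₃, mul_zero]
  have he₂₃ : ⟪e₂, e₃⟫_ℝ = 0 := by rw [he₃_def, inner_smul_right, h₂₃, mul_zero]
  clear_value e₃
  -- the hemisphere over the unit disc, precomposed with a retraction of the plane to the disc
  let ρ : ℂ → ℂ := fun z => ((max 1 ‖z‖)⁻¹ : ℝ) • z
  have hmax : ∀ z : ℂ, max 1 ‖z‖ ≠ 0 := fun z => (lt_max_of_lt_left one_pos).ne'
  have hρcont : Continuous ρ :=
    (Continuous.inv₀ (continuous_const.max continuous_norm) hmax).smul continuous_id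
  have hρ : ∀ z, ‖ρ z‖ ≤ 1 := fun z => by
    simp only [ρ, norm_smul, norm_inv]
    rw [Real.norm_of_nonneg (le_max_of_le_left zero_le_one), inv_mul_le_one₀
      (lt_max_of_lt_left one_pos)]
    exact le_max_right _ _
  let X : ℂ → E := fun z => (ρ z).re • e₁ + (ρ z).im • e₂ + √(1 - ‖ρ z‖ ^ 2) • e₃
  have hXcont : Continuous X := by
    have h1 := Complex.continuous_re.comp hρcont
    have h2 := Complex.continuous_im.comp hρcont
    have h3 : Continuous fun z => √(1 - ‖ρ z‖ ^ 2) :=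
      (continuous_const.sub (hρcont.norm.pow 2)).sqrt
    exact ((h1.smul continuous_const).add (h2.smul continuous_const)).add
      (h3.smul continuous_const)
  have hX : ∀ z, ‖X z‖ = 1 := fun z => by
    have h1 : 0 ≤ 1 - ‖ρ z‖ ^ 2 := by nlinarith [hρ z, norm_nonneg (ρ z)]
    have h2 : ‖X z‖ ^ 2 = 1 := by
      rw [← real_inner_self_eq_norm_sq]
      have k₁ := real_inner_self_eq_norm_sq e₁
      have k₂ := real_inner_self_eq_norm_sq e₂
      have k₃ := real_inner_self_eq_norm_sq e₃
      rw [he₁] at k₁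
      rw [he₂] at k₂
      rw [he₃] at k₃
      simp only [X, inner_add_left, inner_add_right, real_inner_smul_left, real_inner_smul_right,
        k₁, k₂, k₃, he₁₂, he₁₃, he₂₃, real_inner_comm e₁ e₂,
        real_inner_comm e₁ e₃, real_inner_comm e₂ e₃]
      have h3 := Real.mul_self_sqrt h1
      have h4 : ‖ρ z‖ ^ 2 = (ρ z).re * (ρ z).re + (ρ z).im * (ρ z).im := by
        rw [Complex.sq_norm, Complex.normSq_apply]
      linear_combination h3 - h4
    exact (pow_eq_one_iff_of_nonneg (norm_nonneg _) two_ne_zero).1 h2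
  let P : E → ℂ := fun v => ⟨⟪e₁, v⟫_ℝ, ⟪e₂, v⟫_ℝ⟩
  have hPsmul : ∀ (s : ℝ) v, P (s • v) = s * P v := fun s v => by
    apply Complex.ext <;> simp [P, inner_smul_right]
  have hPcont : Continuous P := by
    have : P = fun v => (⟪e₁, v⟫_ℝ : ℂ) + (⟪e₂, v⟫_ℝ : ℂ) * Complex.I := by
      funext v
      apply Complex.ext <;> simp [P]
    rw [this]
    fun_prop
  have hP : ∀ x a b, ‖x‖ = 1 → IsRevolutionAxis N x a b → P a ≠ 0 := fun x a b hx h hPa => by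
    refine hno x hx (h.isEuclideanOn_of_mem_equator hE hN h₀.euclidean (mem_equator.2 ⟨?_, ?_⟩))
    · simpa [P] using congr_arg Complex.re hPa
    · have : ⟪e₂, a⟫_ℝ = 0 := by simpa [P] using congr_arg Complex.im hPa
      rw [he₂_def, real_inner_smul_left] at this
      exact (mul_eq_zero.1 this).resolve_left (inv_ne_zero (norm_ne_zero_iff.2 hb₀))
  choose A B hAB using fun z => hrev (X z) (hX z)
  have hPA : ∀ z, P (A z) ≠ 0 := fun z => hP _ _ _ (hX z) (hAB z)
  -- the square makes the direction of the projected axis independent of the sign of `a`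
  choose F hF using fun z => exists_circle_mul_norm_sq (P (A z))
  refine false_of_extends_neg_sq F ?_ fun z => ?_
  · let R := max (1 / c) C
    let S : Set (ℂ × Circle × Metric.closedBall (0 : E × E) R) :=
      {p | (‖X p.1‖ = 1 ∧ IsRevolutionAxis N (X p.1) (p.2.2 : E × E).1 (p.2.2 : E × E).2) ∧
        (p.2.1 : ℂ) * (‖P (p.2.2 : E × E).1‖ : ℂ) ^ 2 = P (p.2.2 : E × E).1 ^ 2}
    have hS : IsClosed S := by
      refine IsClosed.inter ?_ (isClosed_eq ?_ ?_)
      · exact (isClosed_setOf_isRevolutionAxis hcont).preimage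
          (f := fun p : ℂ × Circle × Metric.closedBall (0 : E × E) R =>
            (X p.1, (p.2.2 : E × E).1, (p.2.2 : E × E).2)) (by fun_prop)
      · fun_prop
      · fun_prop
    refine continuous_of_isClosed_graph_projection F S hS fun z ζ => ⟨?_, ?_⟩
    · rintro rfl
      refine ⟨⟨(A z, B z), ?_⟩, ⟨hX z, hAB z⟩, hF z⟩
      have := (hAB z).norm_le hc hlow hup
      rw [mem_closedBall_zero_iff, Prod.norm_mk]
      exact max_le_max this.1 this.2
    · rintro ⟨⟨⟨a, b⟩, hk⟩, ⟨-, hab⟩, hζ⟩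
      obtain ⟨s, rfl⟩ := (hAB z).unique hE hN hab (hno _ (hX z))
      have hPs := hP _ _ _ (hX z) hab
      simp only [hPsmul] at hζ hPs
      have hs : (s : ℂ) ≠ 0 := left_ne_zero_of_mul hPs
      apply Circle.ext
      have h1 : (‖P (A z)‖ : ℂ) ^ 2 * (s : ℂ) ^ 2 ≠ 0 :=
        mul_ne_zero (pow_ne_zero _ (by simpa using hPA z)) (pow_ne_zero _ hs)
      apply mul_right_cancel₀ h1
      have h2 : ((‖(s : ℂ) * P (A z)‖ : ℝ) : ℂ) ^ 2 = (s : ℂ) ^ 2 * (‖P (A z)‖ : ℂ) ^ 2 := by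
        rw [norm_mul, Complex.norm_real, Complex.ofReal_mul, mul_pow, ← Complex.ofReal_pow,
          Real.norm_eq_abs, sq_abs, Complex.ofReal_pow]
      rw [h2] at hζ
      linear_combination hζ - (s : ℂ) ^ 2 * hF z
  · -- on the unit circle `X z` lies in the plane of `e₁, e₂`
    have hz1 : ‖(z : ℂ)‖ = 1 := Circle.norm_coe z
    have hρz : ρ z = z := by simp [ρ, hz1]
    have hXz : X z = (z : ℂ).re • e₁ + (z : ℂ).im • e₂ := by simp [X, hρz, hz1]
    have horth := (hAB z).inner_x_a
    rw [hXz, inner_add_left, real_inner_smul_left, real_inner_smul_left] at horth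
    have hz : (z : ℂ).re ^ 2 + (z : ℂ).im ^ 2 = 1 := by
      have := Circle.normSq_coe z
      rw [Complex.normSq_apply] at this
      linarith
    have hFz := hF z
    have hne := hPA z
    set u := ⟪e₁, A z⟫_ℝ with hu
    set v := ⟪e₂, A z⟫_ℝ with hv
    set s := (z : ℂ).re * v - (z : ℂ).im * u with hs
    have hPAz : P (A z) = (s : ℂ) * (Complex.I * z) := by
      apply Complex.ext
      · simp only [P, Complex.mul_re, Complex.ofReal_re, Complex.ofReal_im, Complex.I_re,
          Complex.I_im]
        rw [← hu, hs]
        linear_combination (-u) * hz + (z : ℂ).re * horth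
      · simp only [P, Complex.mul_im, Complex.mul_re, Complex.ofReal_re, Complex.ofReal_im,
          Complex.I_re, Complex.I_im]
        rw [← hv, hs]
        linear_combination (-v) * hz + (z : ℂ).im * horth
    have hnorm : (‖P (A z)‖ : ℂ) ^ 2 = (s : ℂ) ^ 2 := by
      rw [hPAz, norm_mul, norm_mul, Complex.norm_I, Circle.norm_coe, Complex.norm_real, one_mul,
        mul_one, ← Complex.ofReal_pow, Real.norm_eq_abs, sq_abs, Complex.ofReal_pow]
    rw [hnorm] at hFz
    have hs0 : (s : ℂ) ^ 2 ≠ 0 := by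
      rw [hPAz] at hne
      exact pow_ne_zero _ (left_ne_zero_of_mul hne)
    apply mul_right_cancel₀ hs0
    rw [hFz, hPAz]
    linear_combination (s : ℂ) ^ 2 * (z : ℂ) ^ 2 * Complex.I_sq

end Topology

/-! ### Convex bodies as unit balls -/

section Bodies

/-- A symmetric convex body is the unit ball of a norm, its gauge. -/
theorem IsSymmetricConvexBody.exists_seminorm {V : Type*} [NormedAddCommGroup V]
    [NormedSpace ℝ V] {B : Set V} (hB : IsSymmetricConvexBody B) :
    ∃ N : Seminorm ℝ V, (∀ v, N v ≤ 1 ↔ v ∈ B) ∧ Continuous N ∧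
      ∃ c C : ℝ, 0 < c ∧ (∀ v, c * ‖v‖ ≤ N v) ∧ ∀ v, N v ≤ C * ‖v‖ := by
  have hnhds : B ∈ nhds (0 : V) := by
    obtain ⟨x, hx⟩ := hB.nonempty_interior
    have h0 := hB.convex.combo_interior_self_mem_interior hx (hB.neg_mem x (interior_subset hx))
      (a := 1 / 2) (b := 1 / 2) (by norm_num) (by norm_num) (by norm_num)
    rw [smul_neg, add_neg_cancel] at h0
    exact mem_interior_iff_mem_nhds.1 h0
  have habs : Absorbent ℝ B := absorbent_nhds_zero hnhds
  have hbal : Balanced ℝ B := (balanced_iff_neg_mem hB.convex).2 fun x hx => hB.neg_mem x hx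
  refine ⟨gaugeSeminorm hbal hB.convex habs, fun v => ?_, continuous_gauge hB.convex hnhds, ?_⟩
  · have := gauge_le_one_iff_mem_closure hB.convex hnhds (x := v)
    rwa [hB.isCompact.isClosed.closure_eq] at this
  · obtain ⟨R, hR, hBR⟩ := hB.isCompact.isBounded.subset_closedBall_lt 0 0
    obtain ⟨r, hr, hrB⟩ := Metric.mem_nhds_iff.1 hnhds
    refine ⟨1 / R, 1 / r, by positivity, fun v => ?_, fun v => ?_⟩
    · have := le_gauge_of_subset_closedBall habs hR.le hBR (x := v)
      rw [one_div_mul_eq_div]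
      exact this
    · have := mul_gauge_le_norm hrB (x := v)
      rw [one_div_mul_eq_div, le_div_iff₀ hr, mul_comm]
      exact this

theorem eq_of_forall_mul_le_one_iff {s t : ℝ} (hs : 0 ≤ s) (ht : 0 ≤ t)
    (h : ∀ c : ℝ, 0 < c → (c * s ≤ 1 ↔ c * t ≤ 1)) : s = t := by
  by_contra hne
  have hpos : 0 < s + t := by
    rcases hs.eq_or_lt with rfl | hs
    · rcases ht.eq_or_lt with rfl | ht
      · exact absurd rfl hne
      · linarith
    · linarith
  have h2 := h (2 / (s + t)) (by positivity)
  rw [div_mul_eq_mul_div, div_mul_eq_mul_div, div_le_one hpos, div_le_one hpos] at h2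
  rcases lt_or_gt_of_ne hne with h1 | h1
  · linarith [h2.1 (by linarith)]
  · linarith [h2.2 (by linarith)]

/-- The norm of a body of revolution depends only on the coordinate along the axis and on the
distance from the axis. -/
theorem IsAxisOfRevolution.exists_seminorm_eq {m : ℕ} {K : Set (EuclideanSpace ℝ (Fin m))}
    {L : Submodule ℝ (EuclideanSpace ℝ (Fin m))} (hL : IsAxisOfRevolution L K)
    (M : Seminorm ℝ (EuclideanSpace ℝ (Fin m))) (hM : ∀ y, M y ≤ 1 ↔ y ∈ K) :
    ∃ l : EuclideanSpace ℝ (Fin m), ‖l‖ = 1 ∧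
      ∀ (t : ℝ) (u u' : EuclideanSpace ℝ (Fin m)), ⟪l, u⟫_ℝ = 0 → ⟪l, u'⟫_ℝ = 0 → ‖u‖ = ‖u'‖ →
        M (t • l + u) = M (t • l + u') := by
  obtain ⟨⟨l₀, hl₀L⟩, hl₀, hspan⟩ := finrank_eq_one_iff'.1 hL.1
  have hl₀' : l₀ ≠ 0 := fun h => hl₀ (Subtype.ext h)
  have hn : ‖l₀‖ ≠ 0 := norm_ne_zero_iff.2 hl₀'
  refine ⟨‖l₀‖⁻¹ • l₀, by rw [norm_smul, norm_inv, norm_norm, inv_mul_cancel₀ hn], ?_⟩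
  set l := ‖l₀‖⁻¹ • l₀ with hl
  have horth : ∀ u, ⟪l, u⟫_ℝ = 0 → u ∈ Lᗮ := fun u hu => by
    rw [Submodule.mem_orthogonal]
    intro v hv
    obtain ⟨c, hc⟩ := hspan ⟨v, hv⟩
    have hc' : c • l₀ = v := congr_arg Subtype.val hc
    rw [hl, real_inner_smul_left] at hu
    rw [← hc', real_inner_smul_left, (mul_eq_zero.1 hu).resolve_left (inv_ne_zero hn), mul_zero]
  have hball : ∀ t : ℝ, ∃ r : ℝ, ∀ u, ⟪l, u⟫_ℝ = 0 → (M (t • l + u) ≤ 1 ↔ ‖u‖ ≤ r) := fun t => by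
    obtain ⟨r, hr⟩ := hL.2 (t • l) (L.smul_mem _ (L.smul_mem _ hl₀L))
    refine ⟨r, fun u hu => ?_⟩
    have hmem : t • l + u ∈ AffineSubspace.mk' (t • l) Lᗮ := by
      rw [AffineSubspace.mem_mk', vsub_eq_sub, add_sub_cancel_left]
      exact horth u hu
    have h1 := Set.ext_iff.1 hr (t • l + u)
    simp only [Set.mem_inter_iff, SetLike.mem_coe, hmem, and_true, Metric.mem_closedBall,
      dist_self_add_left] at h1
    rw [hM, h1]
  intro t u u' hu hu' huu'
  refine eq_of_forall_mul_le_one_iff (apply_nonneg _ _) (apply_nonneg _ _) fun c hc => ?_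
  obtain ⟨r, hr⟩ := hball (c * t)
  have h1 : ∀ u, ⟪l, u⟫_ℝ = 0 → (c * M (t • l + u) ≤ 1 ↔ c * ‖u‖ ≤ r) := fun u hu => by
    have := hr (c • u) (by rw [inner_smul_right, hu, mul_zero])
    rwa [mul_smul, ← smul_add, map_smul_eq_mul, norm_smul, Real.norm_of_nonneg hc.le] at this
  rw [h1 u hu, h1 u' hu', huu']

variable {E : Type*} [NormedAddCommGroup E] [InnerProductSpace ℝ E]

theorem isHyperplane_orthogonal [FiniteDimensional ℝ E] {x : E} (hx : ‖x‖ = 1) :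
    IsHyperplane (ℝ ∙ x)ᗮ := by
  have h1 := Submodule.finrank_quotient_add_finrank (ℝ ∙ x)ᗮ
  have h2 := Submodule.finrank_add_finrank_orthogonal (ℝ ∙ x)
  have hx0 : x ≠ 0 := fun h => by simp [h] at hx
  rw [finrank_span_singleton hx0] at h2
  unfold IsHyperplane
  omega

theorem IsAffineBodyOfRevolution.exists_isRevolutionAxis [FiniteDimensional ℝ E] {B : Set E}
    {N : Seminorm ℝ E} (hNB : ∀ v, N v ≤ 1 ↔ v ∈ B) (hN : ∀ v, N v = 0 → v = 0) {x : E}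
    (h : IsAffineBodyOfRevolution (linearSection B (ℝ ∙ x)ᗮ)) :
    ∃ a b, IsRevolutionAxis N x a b := by
  obtain ⟨m, K, ⟨-, L, hL⟩, T, rfl⟩ := h
  set M : Seminorm ℝ (EuclideanSpace ℝ (Fin m)) :=
    N.comp ((ℝ ∙ x)ᗮ.subtype.comp T.symm.toLinearMap) with hM_def
  have hM : ∀ y, M y = N (T.symm y) := fun y => rfl
  obtain ⟨l, hl, hrot⟩ := hL.exists_seminorm_eq M fun y => by
    rw [hM, hNB]
    constructor
    · intro hy
      exact ⟨T.symm y, hy, T.apply_symm_apply y⟩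
    · rintro ⟨v, hv, rfl⟩
      rw [T.symm_apply_apply]
      exact hv
  have hll : ⟪l, l⟫_ℝ = 1 := by rw [real_inner_self_eq_norm_sq, hl, one_pow]
  have hMl : M l ≠ 0 := fun h0 => by
    have h1 : T.symm l = 0 := Subtype.ext (hN _ h0)
    rw [LinearEquiv.map_eq_zero_iff] at h1
    rw [h1, norm_zero] at hl
    exact zero_ne_one hl
  have hMlpos : 0 < M l := lt_of_le_of_ne (apply_nonneg M l) (Ne.symm hMl)
  let φ : (ℝ ∙ x)ᗮ →ₗ[ℝ] ℝ := (M l) • (innerₗ _ l).comp T.toLinearMap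
  let b : (ℝ ∙ x)ᗮ := (InnerProductSpace.toDual ℝ _).symm (LinearMap.toContinuousLinearMap φ)
  have hb : ∀ v : (ℝ ∙ x)ᗮ, ⟪(b : E), (v : E)⟫_ℝ = M l * ⟪l, T v⟫_ℝ := fun v =>
    InnerProductSpace.toDual_symm_apply (x := v) (y := LinearMap.toContinuousLinearMap φ)
  have hperp : ∀ v : (ℝ ∙ x)ᗮ, ⟪x, (v : E)⟫_ℝ = 0 := fun v =>
    Submodule.mem_orthogonal_singleton_iff_inner_right.1 v.2
  -- the equator corresponds to the orthogonal complement of the axis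
  have heq : ∀ v ∈ equator x b, ∃ y, ⟪l, y⟫_ℝ = 0 ∧ v = T.symm y := fun v hv => by
    rw [mem_equator] at hv
    refine ⟨T ⟨v, Submodule.mem_orthogonal_singleton_iff_inner_right.2 hv.1⟩, ?_, by simp⟩
    have h1 := hb ⟨v, Submodule.mem_orthogonal_singleton_iff_inner_right.2 hv.1⟩
    exact (mul_eq_zero.1 (h1.symm.trans hv.2)).resolve_left hMl
  obtain ⟨k, hk⟩ : ∃ k : ℝ, ∀ y, ⟪l, y⟫_ℝ = 0 → M y = k * ‖y‖ := by
    by_cases hex : ∃ y₀, ⟪l, y₀⟫_ℝ = 0 ∧ y₀ ≠ 0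
    · obtain ⟨y₀, hy₀, hne⟩ := hex
      refine ⟨M y₀ / ‖y₀‖, fun y hy => ?_⟩
      have h1 := hrot 0 (‖y₀‖ • y) (‖y‖ • y₀) (by rw [inner_smul_right, hy, mul_zero])
        (by rw [inner_smul_right, hy₀, mul_zero])
        (by rw [norm_smul, norm_smul, norm_norm, norm_norm, mul_comm])
      rw [zero_smul, zero_add, zero_add, map_smul_eq_mul, map_smul_eq_mul, norm_norm,
        norm_norm] at h1
      rw [div_mul_eq_mul_div, eq_div_iff (norm_ne_zero_iff.2 hne)]
      linarith
    · push Not at hex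
      exact ⟨0, fun y hy => by rw [hex y hy, map_zero, norm_zero, mul_zero]⟩
  refine ⟨((M l)⁻¹ • T.symm l : (ℝ ∙ x)ᗮ), b, ?_⟩
  constructor
  · exact hperp _
  · exact hperp _
  · rw [hb, map_smul, T.apply_symm_apply, inner_smul_right, hll, mul_one, mul_inv_cancel₀ hMl]
  · rw [Submodule.coe_smul, map_smul_eq_mul, ← hM, norm_inv, Real.norm_of_nonneg hMlpos.le,
      inv_mul_cancel₀ hMl]
  · intro v hv w hw
    obtain ⟨y, hy, rfl⟩ := heq v hv
    obtain ⟨z, hz, rfl⟩ := heq w hw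
    rw [← Submodule.coe_add, ← Submodule.coe_sub, ← map_add, ← map_sub, ← hM, ← hM, ← hM, ← hM,
      hk y hy, hk z hz, hk _ (by rw [inner_add_right, hy, hz, add_zero]),
      hk _ (by rw [inner_sub_right, hy, hz, sub_zero])]
    linear_combination k ^ 2 * parallelogram_law_with_norm ℝ y z
  · intro v hv w hw t
    obtain ⟨y, hy, rfl⟩ := heq v hv
    obtain ⟨z, hz, rfl⟩ := heq w hw
    have h1 := hrot (t * (M l)⁻¹) (M z • y) (M y • z) (by rw [inner_smul_right, hy, mul_zero])
      (by rw [inner_smul_right, hz, mul_zero]) (by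
        rw [norm_smul, norm_smul, Real.norm_of_nonneg (apply_nonneg M z),
          Real.norm_of_nonneg (apply_nonneg M y), hk y hy, hk z hz]
        ring)
    simpa only [hM, map_add, map_smul, Submodule.coe_add, Submodule.coe_smul, mul_smul] using h1

theorem IsEuclideanOn.isEllipsoid [FiniteDimensional ℝ E] {B : Set E} {N : Seminorm ℝ E}
    (hNB : ∀ v, N v ≤ 1 ↔ v ∈ B) (hN : ∀ v, N v = 0 → v = 0) {H : Submodule ℝ E}
    (h : IsEuclideanOn N H) : IsEllipsoid (linearSection B H) := by
  obtain ⟨m, T, hT⟩ := exists_linearEquiv_norm_eq (N.comp H.subtype)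
    (fun v hv => Subtype.ext (hN v hv)) (fun v w => h v v.2 w w.2)
  refine ⟨m, T.toAffineEquiv, ?_⟩
  ext y
  rw [mem_closedBall_zero_iff]
  constructor
  · rintro ⟨v, hv, rfl⟩
    have := hT v
    rw [LinearEquiv.coe_toAffineEquiv, this]
    exact (hNB v).2 hv
  · intro hy
    refine ⟨T.symm y, (hNB _).1 ?_, T.apply_symm_apply y⟩
    have := hT (T.symm y)
    rw [T.apply_symm_apply] at this
    rw [this] at hy
    exact hy

end Bodies

end BodiesOfRevolution

theorem theorem3 (n : ℕ) (hn : 4 ≤ n) (B : Set (EuclideanSpace ℝ (Fin (n + 1))))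
    (hB : BodiesOfRevolution.IsSymmetricConvexBody B)
    (hrev : ∀ H : Submodule ℝ (EuclideanSpace ℝ (Fin (n + 1))),
      BodiesOfRevolution.IsHyperplane H →
        BodiesOfRevolution.IsAffineBodyOfRevolution (BodiesOfRevolution.linearSection B H)) :
    ∃ H : Submodule ℝ (EuclideanSpace ℝ (Fin (n + 1))),
      BodiesOfRevolution.IsHyperplane H ∧
        BodiesOfRevolution.IsEllipsoid (BodiesOfRevolution.linearSection B H) := by
  obtain ⟨N, hNB, hcont, c, C, hc, hlow, hup⟩ := hB.exists_seminorm
  have hN : ∀ v, N v = 0 → v = 0 := fun v hv => by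
    have := hlow v
    rw [hv] at this
    exact norm_le_zero_iff.1 (nonpos_of_mul_nonpos_right this hc)
  obtain ⟨x, hx, hEucl⟩ := BodiesOfRevolution.exists_isEuclideanOn_orthogonal
    (by rw [finrank_euclideanSpace_fin]; omega) hc hlow hup hcont fun x hx =>
      (hrev _ (BodiesOfRevolution.isHyperplane_orthogonal hx)).exists_isRevolutionAxis hNB hN
  exact ⟨_, BodiesOfRevolution.isHyperplane_orthogonal hx, hEucl.isEllipsoid hNB hN⟩
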